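/- Let $\alpha_R,\alpha_F\in[0,1)$, let $T_{\rm D}:\mathbb R\rightrightarrows\mathbb R$ be a monotone, outer semicontinuous set-valued operator, and let $r>0$, $v_{\rm in}\in\mathbb R$, $v_+>0$. The Ebers--Moll transistor with leakage is the set-valued operator on $\mathbb R^2$ $$T_{{\rm NPN},r}(v_1,v_2)=\left\{\begin{pmatrix}1&-\alpha_R\\-\alpha_F&1\end{pmatrix}\begin{pmatrix}u_1\\u_2\end{pmatrix}+\frac1r\begin{pmatrix}v_1\\v_2\end{pmatrix} : u_1\in T_{\rm D}(v_1),\ u_2\in T_{\rm D}(v_2)\right\}.$$ Let $R_C,R_E:\mathbb R\rightrightarrows\mathbb R$ be outer semicontinuous (possibly multi-valued) operators, put $R(i_1,i_2)=R_C(i_1)\times R_E(i_2)$, $G=T_{{\rm NPN},r}$, $s_v=(v_+-v_{\rm in},\,-v_{\rm in})$, and consider the common-emitter amplifier inclusion in $(i,v)\in\mathbb R^2\times\mathbb R^2$ $$0\in R(i)+v+s_v,\qquad 0\in G(v)-i. \tag{1}$$ An operator $A$ is called $(\mu,\rho)$-semimonotone if $\langle x-y,u-w\rangle\ge\mu\|x-y\|^2+\rho\|u-w\|^2$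 for all $u\in A(x)$, $w\in A(y)$; it is $\sigma$-monotone if it is $(\sigma,0)$-semimonotone. For an operator $T$ and $\gamma>0$ let $J_{\gamma T}=(\mathrm{id}+\gamma T)^{-1}$, and let $\tilde R(i)=R(i)+s_v$. A sequence $(i^k,v^k)_{k\in\mathbb N}$ in $\mathbb R^2\times\mathbb R^2$ is generated by the Chambolle--Pock algorithm with stepsizes $\gamma,\tau$ and relaxation parameter $\lambda$ if, for some sequences $(\bar i^k)$, $(\bar v^k)$ and every $k$, $$\bar i^k\in J_{\gamma\tilde R}(i^k-\gamma v^k),\quad \bar v^k\in J_{\tau G}\bigl(v^k+\tau(2\bar i^k-i^k)\bigr),\quad i^{k+1}=i^k+\lambda(\bar i^k-i^k),\quad v^{k+1}=v^k+\lambda(\bar v^k-v^k).$$ Suppose that one of the following holds. (i) $R_C$ and $R_E$ are $\sigma$-monotone for some $\sigma>\frac{r(\sqrt2-1)}2$, and, with $\underline\tau:=-\frac{\sigma r(1-\sqrt2)}{r(1-\sqrt2)+2\sigma}$, it holds that $\tau\in(\underline\tau,+\infty)$, $\gamma\in(0,1/\tau)$ and $\lambda\in\bigl(0,\,2(1-\underline\tau/\tau)\bigr)$.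 (ii) $R_C$ and $R_E$ are $\bigl(\frac98r,-\frac1{8r}\bigr)$-semimonotone and, with $\underline\gamma:=\frac{5-\sqrt{10}}{9r}$ and $\overline\gamma:=\frac{5+\sqrt{10}}{9r}$, it holds that $\gamma\in(\underline\gamma,\overline\gamma)$, $\tau\in(1/\overline\gamma,1/\gamma)$ and $\lambda\in\bigl(0,\,2\bigl(1-\frac1{6r\gamma}-\frac{9}{10\tau}r\bigr)\bigr)$. Then any sequence $(i^k,v^k)_{k\in\mathbb N}$ generated by the Chambolle--Pock algorithm with stepsizes $\gamma,\tau$ and relaxation parameter $\lambda$ converges to a solution of (1). -/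

import Mathlib

open scoped Pointwise

/-- A set-valued operator `A : E ⇉ F`. -/
abbrev SetValuedMap (E F : Type*) := E → Set F

namespace SetValuedMap

/-- The inverse operator: `x ∈ A⁻¹(u)` if and only if `u ∈ A(x)`. -/
def inverse {E F : Type*} (A : SetValuedMap E F) : SetValuedMap F E :=
  fun u => {x | u ∈ A x}

/-- Outer semicontinuity (at every point): whenever `x k → x`, `u k ∈ A (x k)` and `u k → u`,
also `u ∈ A x`. -/
def OuterSemicontinuous {E F : Type*} [TopologicalSpace E] [TopologicalSpace F]
    (A : SetValuedMap E F) : Prop :=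
  ∀ (x : E) (u : F) (xs : ℕ → E) (us : ℕ → F),
    Filter.Tendsto xs Filter.atTop (nhds x) → Filter.Tendsto us Filter.atTop (nhds u) →
    (∀ k, us k ∈ A (xs k)) → u ∈ A x

section InnerProduct

variable {E : Type*} [NormedAddCommGroup E] [InnerProductSpace ℝ E]

/-- `A` is monotone: `⟨x - y, u - v⟩ ≥ 0` for all `(x, u), (y, v)` in the graph of `A`. -/
def IsMonotone (A : SetValuedMap E E) : Prop :=
  ∀ x y u v : E, u ∈ A x → v ∈ A y → 0 ≤ inner ℝ (x - y) (u - v)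

/-- `A` is `σ`-monotone: `⟨x - y, u - v⟩ ≥ σ ‖x - y‖²` on the graph of `A`. -/
def IsSigmaMonotone (A : SetValuedMap E E) (σ : ℝ) : Prop :=
  ∀ x y u v : E, u ∈ A x → v ∈ A y → σ * ‖x - y‖ ^ 2 ≤ inner ℝ (x - y) (u - v)

/-- `A` is `(μ, ρ)`-semimonotone:
`⟨x - y, u - v⟩ ≥ μ ‖x - y‖² + ρ ‖u - v‖²` on the graph of `A`. -/
def IsSemimonotone (A : SetValuedMap E E) (μ ρ : ℝ) : Prop :=
  ∀ x y u v : E, u ∈ A x → v ∈ A y →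
    μ * ‖x - y‖ ^ 2 + ρ * ‖u - v‖ ^ 2 ≤ inner ℝ (x - y) (u - v)

/-- The resolvent `J_{γ T} = (id + γ T)⁻¹`. -/
def resolvent (γ : ℝ) (T : SetValuedMap E E) : SetValuedMap E E :=
  inverse (fun x => {x} + γ • T x)

end InnerProduct

end SetValuedMap

namespace Circuit

open SetValuedMap

/-- `(i, v)` solves the circuit inclusion
`0 ∈ (R(i), G(v)) + [[0, Lᵀ], [-L, 0]] (i, v) + (s_v, s_i)`. -/
def IsSolution {n m : ℕ}
    (R : SetValuedMap (EuclideanSpace ℝ (Fin n)) (EuclideanSpace ℝ (Fin n)))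
    (G : SetValuedMap (EuclideanSpace ℝ (Fin m)) (EuclideanSpace ℝ (Fin m)))
    (L : Matrix (Fin m) (Fin n) ℝ)
    (s_v : EuclideanSpace ℝ (Fin n)) (s_i : EuclideanSpace ℝ (Fin m))
    (i : EuclideanSpace ℝ (Fin n)) (v : EuclideanSpace ℝ (Fin m)) : Prop :=
  0 ∈ R i + {Matrix.toEuclideanLin L.transpose v} + {s_v} ∧
  0 ∈ G v + {-(Matrix.toEuclideanLin L i)} + {s_i}

/-- `(i k, v k)` is a sequence generated by the Chambolle--Pock algorithm for the circuit
inclusion, with stepsizes `γ`, `τ` and relaxation parameter `lam`. -/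
def IsChambollePock {n m : ℕ}
    (R : SetValuedMap (EuclideanSpace ℝ (Fin n)) (EuclideanSpace ℝ (Fin n)))
    (G : SetValuedMap (EuclideanSpace ℝ (Fin m)) (EuclideanSpace ℝ (Fin m)))
    (L : Matrix (Fin m) (Fin n) ℝ)
    (s_v : EuclideanSpace ℝ (Fin n)) (s_i : EuclideanSpace ℝ (Fin m))
    (γ τ lam : ℝ)
    (i : ℕ → EuclideanSpace ℝ (Fin n)) (v : ℕ → EuclideanSpace ℝ (Fin m)) : Prop :=
  ∃ (ibar : ℕ → EuclideanSpace ℝ (Fin n)) (vbar : ℕ → EuclideanSpace ℝ (Fin m)),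
    ∀ k : ℕ,
      ibar k ∈ resolvent γ (fun x => R x + {s_v})
        (i k - γ • Matrix.toEuclideanLin L.transpose (v k)) ∧
      vbar k ∈ resolvent τ (fun y => G y + {s_i})
        (v k + τ • Matrix.toEuclideanLin L ((2 : ℝ) • ibar k - i k)) ∧
      i (k + 1) = i k + lam • (ibar k - i k) ∧
      v (k + 1) = v k + lam • (vbar k - v k)

/-- The product `A × B : ℝ² ⇉ ℝ²` of two operators on the real line. -/
def prodMap (A B : SetValuedMap ℝ ℝ) :
    SetValuedMap (EuclideanSpace ℝ (Fin 2)) (EuclideanSpace ℝ (Fin 2)) :=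
  fun x => {u | u 0 ∈ A (x 0) ∧ u 1 ∈ B (x 1)}

/-- The Ebers--Moll NPN transistor with diode law `TD`, reverse short-circuit current ratio `αR`
and forward short-circuit current ratio `αF`. -/
def npn (αR αF : ℝ) (TD : SetValuedMap ℝ ℝ) :
    SetValuedMap (EuclideanSpace ℝ (Fin 2)) (EuclideanSpace ℝ (Fin 2)) :=
  fun v => Matrix.toEuclideanLin !![1, -αR; -αF, 1] '' prodMap TD TD v

/-- The NPN transistor with leakage resistance `r`: the operator `T_NPN + (1 / r) id`. -/
def leakyNPN (r αR αF : ℝ) (TD : SetValuedMap ℝ ℝ) :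
    SetValuedMap (EuclideanSpace ℝ (Fin 2)) (EuclideanSpace ℝ (Fin 2)) :=
  fun v => npn αR αF TD v + {(1 / r) • v}

end Circuit

open Filter Topology

/-! The iteration is a relaxed proximal point method: `P (z - z̄) ∈ T z̄` with `z = (i, v)`, `T` the
primal-dual operator and `P = [[1/γ, -1], [-1, 1/τ]]`, positive definite because `γτ < 1`. No
solution is known to exist beforehand, so consecutive iterates are compared with each other instead
of with a solution. The `P`-norm of `z (k+1) - z k` shrinks by a fixed factor
(`exists_contraction_rate`), hence the iterates are Cauchy, and outer semicontinuity makes the limit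
a solution.

The contraction survives negative moduli because the coupling lets each operator pay for the other:
the deficit of `R` is charged to the strong monotonicity of `G` and conversely (`exists_coercive`).
What remains is `a`, `b` times squared residuals, which costs `a/γ + b/τ` in the range of `lam`. The
circuit enters through a one-parameter family of moduli for the transistor
(`leakyNPN_isSemimonotone`); the two cases are two choices of its parameter `s`. -/

lemma cauchySeq_of_norm_sq_le_geometric {E : Type*} [SeminormedAddCommGroup E] {x : ℕ → E} {B θ : ℝ} (hθ : 0 ≤ θ) (hθ1 : θ < 1)
    (h : ∀ k, ‖x (k + 1) - x k‖ ^ 2 ≤ B * θ ^ k) : CauchySeq x := by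
  have hB : 0 ≤ B := by simpa using (sq_nonneg _).trans (h 0)
  refine cauchySeq_of_le_geometric (√θ) (√B) (by rw [Real.sqrt_lt' one_pos]; simpa) fun k => ?_
  rw [dist_comm, dist_eq_norm]
  refine Real.le_sqrt_of_sq_le (h k) |>.trans_eq ?_
  rw [Real.sqrt_mul hB]
  congr 1
  rw [Real.sqrt_eq_iff_mul_self_eq (by positivity) (by positivity), ← mul_pow,
    Real.mul_self_sqrt hθ]

/-! ### The preconditioner form and its contraction. -/

section Preconditioned

variable {E : Type*} [NormedAddCommGroup E] [InnerProductSpace ℝ E]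

/-- The quadratic form `α ‖p‖² - 2 ⟨p, q⟩ + β ‖q‖²` of the Chambolle--Pock preconditioner. -/
noncomputable def precondSq (α β : ℝ) (p q : E) : ℝ :=
  α * ‖p‖ ^ 2 - 2 * inner ℝ p q + β * ‖q‖ ^ 2

lemma precondSq_le (α β : ℝ) (p q : E) :
    precondSq α β p q ≤ (|α| + |β| + 1) * (‖p‖ ^ 2 + ‖q‖ ^ 2) := by
  have h : 0 ≤ ‖p + q‖ ^ 2 := sq_nonneg _
  rw [norm_add_sq_real] at h
  unfold precondSq
  have h1 := mul_le_mul_of_nonneg_right (le_abs_self α) (sq_nonneg ‖p‖)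
  have h2 := mul_le_mul_of_nonneg_right (le_abs_self β) (sq_nonneg ‖q‖)
  have h3 := mul_nonneg (abs_nonneg α) (sq_nonneg ‖q‖)
  have h4 := mul_nonneg (abs_nonneg β) (sq_nonneg ‖p‖)
  linarith

lemma le_precondSq {α β : ℝ} (hβ : 0 < β) (p q : E) :
    (α - 1 / β) * ‖p‖ ^ 2 ≤ precondSq α β p q := by
  have h : 0 ≤ ‖p - β • q‖ ^ 2 := sq_nonneg _
  rw [norm_sub_sq_real, inner_smul_right, norm_smul, Real.norm_eq_abs, mul_pow, sq_abs] at h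
  have e : precondSq α β p q - (α - 1 / β) * ‖p‖ ^ 2 =
      (‖p‖ ^ 2 - 2 * (β * inner ℝ p q) + β ^ 2 * ‖q‖ ^ 2) / β := by
    unfold precondSq
    field_simp
    ring
  have := div_nonneg h hβ.le
  linarith

lemma precondSq_comm (α β : ℝ) (p q : E) : precondSq α β p q = precondSq β α q p := by
  unfold precondSq
  rw [real_inner_comm]
  ring

lemma precondSq_nonneg {α β : ℝ} (hβ : 0 < β) (hαβ : 1 < α * β) (p q : E) :
    0 ≤ precondSq α β p q := by
  refine le_trans ?_ (le_precondSq hβ p q)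
  have : 1 / β < α := by rwa [div_lt_iff₀ hβ]
  exact mul_nonneg (by linarith) (sq_nonneg _)

lemma precondSq_parallelogram (α β : ℝ) (p q e f : E) :
    precondSq α β (p + e) (q + f) + precondSq α β (p - e) (q - f) =
      2 * precondSq α β p q + 2 * precondSq α β e f := by
  unfold precondSq
  simp only [norm_add_sq_real, norm_sub_sq_real, inner_add_left, inner_add_right,
    inner_sub_left, inner_sub_right]
  ring

/-- The relaxed step expands the quadratic form of the preconditioner. -/
lemma precondSq_relaxed_step (α β lam : ℝ) (p q e f : E) :
    precondSq α β (p - lam • e) (q - lam • f) =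
      precondSq α β p q
        - 2 * lam * (inner ℝ (p - e) (α • e - f) + inner ℝ (q - f) (β • f - e))
        - lam * (2 - lam) * precondSq α β e f := by
  unfold precondSq
  simp only [norm_sub_sq_real, inner_sub_left, inner_sub_right, inner_smul_left,
    inner_smul_right, norm_smul, Real.norm_eq_abs, mul_pow, sq_abs, real_inner_self_eq_norm_sq,
    conj_trivial, real_inner_comm e p, real_inner_comm f q,
    real_inner_comm e f, real_inner_comm q e]
  ring

/-- `α * precondSq α β e f - ‖α • e - f‖ ^ 2 = (α * β - 1) * ‖f‖ ^ 2`, and symmetrically for `β`. -/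
lemma residual_sq_le {α β a b : ℝ} (ha : 0 ≤ a) (hb : 0 ≤ b) (hαβ : 1 < α * β) (e f : E) :
    a * ‖α • e - f‖ ^ 2 + b * ‖β • f - e‖ ^ 2 ≤ (a * α + b * β) * precondSq α β e f := by
  unfold precondSq
  simp only [norm_sub_sq_real, inner_smul_left, norm_smul, Real.norm_eq_abs, mul_pow, sq_abs,
    conj_trivial, real_inner_comm e f]
  nlinarith [mul_nonneg (mul_nonneg ha (sub_nonneg.2 hαβ.le)) (sq_nonneg ‖f‖),
    mul_nonneg (mul_nonneg hb (sub_nonneg.2 hαβ.le)) (sq_nonneg ‖e‖)]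

/-- A quadratic form with positive definite coefficient matrix is strictly coercive. -/
lemma exists_coercive {ρ a μ : ℝ} (ha : ρ < a) (h : ρ ^ 2 < (a - ρ) * (μ - ρ)) :
    ∃ c > 0, ∀ x y : E, c * ‖x‖ ^ 2 - a * ‖y‖ ^ 2 ≤ μ * ‖x‖ ^ 2 - ρ * ‖y - x‖ ^ 2 := by
  have ha' : 0 < a - ρ := sub_pos.2 ha
  -- The Schur complement left after completing the square in `y`.
  refine ⟨((a - ρ) * (μ - ρ) - ρ ^ 2) / (a - ρ), div_pos (by linarith) ha', fun x y => ?_⟩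
  have hs : 0 ≤ ‖(a - ρ) • y + ρ • x‖ ^ 2 := sq_nonneg _
  rw [norm_add_sq_real, inner_smul_left, inner_smul_right, norm_smul, norm_smul, mul_pow,
    mul_pow, Real.norm_eq_abs, Real.norm_eq_abs, sq_abs, sq_abs, conj_trivial] at hs
  have e : μ * ‖x‖ ^ 2 - ρ * ‖y - x‖ ^ 2 -
      (((a - ρ) * (μ - ρ) - ρ ^ 2) / (a - ρ) * ‖x‖ ^ 2 - a * ‖y‖ ^ 2) =
      ((a - ρ) ^ 2 * ‖y‖ ^ 2 + 2 * ((a - ρ) * (ρ * inner ℝ y x)) + ρ ^ 2 * ‖x‖ ^ 2) / (a - ρ) := by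
    rw [norm_sub_sq_real]
    field_simp
    ring
  have := div_nonneg hs ha'.le
  linarith

/-- Under a coercive oblique Minty inequality the relaxed step contracts the preconditioner
norm, at a rate depending only on the constants. -/
lemma exists_contraction_rate {α β a b c lam : ℝ} (hβ : 0 < β)
    (hαβ : 1 < α * β) (ha : 0 ≤ a) (hb : 0 ≤ b) (hc : 0 < c) (hlam : 0 < lam)
    (hlam' : lam < 2 * (1 - (a * α + b * β))) :
    ∃ θ : ℝ, 0 ≤ θ ∧ θ < 1 ∧ ∀ p q e f : E,
      c * (‖p - e‖ ^ 2 + ‖q - f‖ ^ 2) - a * ‖α • e - f‖ ^ 2 - b * ‖β • f - e‖ ^ 2 ≤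
        inner ℝ (p - e) (α • e - f) + inner ℝ (q - f) (β • f - e) →
      precondSq α β (p - lam • e) (q - lam • f) ≤ θ * precondSq α β p q := by
  set C := |α| + |β| + 1 with hC
  have hC0 : 0 < C := by positivity
  set δ := lam * (2 * (1 - (a * α + b * β)) - lam) with hδ
  have hδ0 : 0 < δ := mul_pos hlam (by linarith)
  -- The step decreases the form by at least `2 * lam * c * Z + δ * M`, while `N ≤ 2 * C * Z + 2 *
  -- M`; so the decrease is at least `N / K`. The final `+ 1` keeps the rate nonnegative.
  set K := C / (lam * c) + 2 / δ + 1 with hK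
  have hlc : 0 < lam * c := mul_pos hlam hc
  have h1 : 0 < C / (lam * c) := div_pos hC0 hlc
  have h2 : 0 < 2 / δ := div_pos two_pos hδ0
  have hK1 : 1 < K := by linarith
  have hK0 : 0 < K := by linarith
  refine ⟨1 - 1 / K, ?_, ?_, fun p q e f h => ?_⟩
  · rw [sub_nonneg, div_le_one hK0]
    exact hK1.le
  · have : 0 < 1 / K := by positivity
    linarith
  set N := precondSq α β p q
  set M := precondSq α β e f
  set Z := ‖p - e‖ ^ 2 + ‖q - f‖ ^ 2
  have hZ : 0 ≤ Z := by positivity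
  have hM : 0 ≤ M := precondSq_nonneg hβ hαβ e f
  have hres := residual_sq_le ha hb hαβ e f
  have hNZ : N ≤ 2 * (C * Z) + 2 * M := by
    have hp := precondSq_parallelogram α β (p - e) (q - f) e f
    have hpos := precondSq_nonneg hβ hαβ (p - e - e) (q - f - f)
    have hle : precondSq α β (p - e) (q - f) ≤ C * Z := precondSq_le α β _ _
    rw [sub_add_cancel, sub_add_cancel] at hp
    linarith
  have hdec : N ≤ K * (2 * (lam * c) * Z + δ * M) := by
    have e1 : C / (lam * c) * (2 * (lam * c) * Z) = 2 * (C * Z) := by field_simp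
    have e2 : 2 / δ * (δ * M) = 2 * M := by field_simp
    have n1 : 0 ≤ C / (lam * c) * (δ * M) := by positivity
    have n2 : 0 ≤ 2 / δ * (2 * (lam * c) * Z) := by positivity
    have n3 : 0 ≤ 2 * (lam * c) * Z + δ * M := by positivity
    rw [hK]
    linarith
  have hdec' : N / K ≤ 2 * (lam * c) * Z + δ * M := by
    rw [div_le_iff₀ hK0]
    linarith
  rw [precondSq_relaxed_step]
  have hl := mul_le_mul_of_nonneg_left (h.trans' (by
    linarith : c * Z - (a * α + b * β) * M ≤ _)) hlam.le
  have e : (1 - 1 / K) * N = N - N / K := by ring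
  have eδ : δ * M = lam * (2 * (1 - (a * α + b * β)) - lam) * M := rfl
  change N - 2 * lam * _ - lam * (2 - lam) * M ≤ _
  rw [e]
  linarith

end Preconditioned

/-! ### Convergence of the abstract iteration. -/

namespace SetValuedMap

variable {E : Type*} [NormedAddCommGroup E] [InnerProductSpace ℝ E]

/-- Convergence of the Chambolle--Pock iteration with identity coupling for two semimonotone
operators whose moduli compensate each other with some slack. -/
theorem chambollePock_tendsto [CompleteSpace E] {R G : SetValuedMap E E}
    (hRo : R.OuterSemicontinuous) (hGo : G.OuterSemicontinuous)
    {μ₁ ρ₁ μ₂ ρ₂ a b γ τ lam : ℝ}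
    (hR : R.IsSemimonotone μ₁ (-ρ₁)) (hG : G.IsSemimonotone μ₂ (-ρ₂))
    (hρ₁ : 0 ≤ ρ₁) (hρ₂ : 0 ≤ ρ₂) (ha : ρ₁ < a) (hb : ρ₂ < b)
    (hav : ρ₁ ^ 2 < (a - ρ₁) * (μ₂ - ρ₁)) (hbi : ρ₂ ^ 2 < (b - ρ₂) * (μ₁ - ρ₂))
    (hγ : 0 < γ) (hτ : 0 < τ) (hγτ : γ * τ < 1)
    (hlam : 0 < lam) (hlam' : lam < 2 * (1 - (a / γ + b / τ)))
    (s : E) {i v ibar vbar w g : ℕ → E}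
    (hw : ∀ k, w k ∈ R (ibar k)) (hg : ∀ k, g k ∈ G (vbar k))
    (hi : ∀ k, ibar k + γ • (w k + s) = i k - γ • v k)
    (hv : ∀ k, vbar k + τ • g k = v k + τ • ((2 : ℝ) • ibar k - i k))
    (hi' : ∀ k, i (k + 1) = i k + lam • (ibar k - i k))
    (hv' : ∀ k, v (k + 1) = v k + lam • (vbar k - v k)) :
    ∃ iStar vStar : E, -vStar - s ∈ R iStar ∧ iStar ∈ G vStar ∧
      Tendsto i atTop (𝓝 iStar) ∧ Tendsto v atTop (𝓝 vStar) := by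
  have hα : 0 < γ⁻¹ := inv_pos.2 hγ
  have hβ : 0 < τ⁻¹ := inv_pos.2 hτ
  have hαβ : 1 < γ⁻¹ * τ⁻¹ := by
    rw [← mul_inv]
    exact (one_lt_inv₀ (mul_pos hγ hτ)).2 hγτ
  have hwk : ∀ k, w k = γ⁻¹ • (i k - ibar k) - v k - s := fun k => by
    have : γ • w k = (i k - ibar k) - γ • v k - γ • s := by
      have := hi k
      rw [smul_add] at this
      linear_combination (norm := module) this
    rw [← inv_smul_smul₀ hγ.ne' (w k), this, smul_sub, smul_sub, inv_smul_smul₀ hγ.ne',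
      inv_smul_smul₀ hγ.ne']
  have hgk : ∀ k, g k = τ⁻¹ • (v k - vbar k) + (2 : ℝ) • ibar k - i k := fun k => by
    have : τ • g k = (v k - vbar k) + τ • ((2 : ℝ) • ibar k - i k) := by
      linear_combination (norm := module) hv k
    rw [← inv_smul_smul₀ hτ.ne' (g k), this, smul_add, inv_smul_smul₀ hτ.ne', add_sub_assoc]
  obtain ⟨c₁, hc₁, hco₁⟩ := exists_coercive (E := E) ha hav
  obtain ⟨c₂, hc₂, hco₂⟩ := exists_coercive (E := E) hb hbi
  obtain ⟨θ, hθ, hθ1, hθc⟩ := exists_contraction_rate (E := E) hβ hαβ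
    (hρ₁.trans ha.le) (hρ₂.trans hb.le) (lt_min hc₁ hc₂) hlam (by simpa [div_eq_mul_inv] using hlam')
  have hstep : ∀ k, precondSq γ⁻¹ τ⁻¹ (i (k + 1 + 1) - i (k + 1)) (v (k + 1 + 1) - v (k + 1)) ≤
      θ * precondSq γ⁻¹ τ⁻¹ (i (k + 1) - i k) (v (k + 1) - v k) := fun k => by
    set e := (i (k + 1) - ibar (k + 1)) - (i k - ibar k) with he
    set f := (v (k + 1) - vbar (k + 1)) - (v k - vbar k) with hf
    have e1 : i (k + 1 + 1) - i (k + 1) = (i (k + 1) - i k) - lam • e := by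
      rw [hi' (k + 1), he]
      nth_rw 4 [hi' k]
      module
    have e2 : v (k + 1 + 1) - v (k + 1) = (v (k + 1) - v k) - lam • f := by
      rw [hv' (k + 1), hf]
      nth_rw 4 [hv' k]
      module
    rw [e1, e2]
    apply hθc
    have hpe : (i (k + 1) - i k) - e = ibar (k + 1) - ibar k := by rw [he]; abel
    have hqf : (v (k + 1) - v k) - f = vbar (k + 1) - vbar k := by rw [hf]; abel
    have hRk := hR _ _ _ _ (hw (k + 1)) (hw k)
    have hGk := hG _ _ _ _ (hg (k + 1)) (hg k)
    -- Each output difference is a residual plus or minus the other variable's increment. The skew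
    -- cross terms cancel on adding the two inequalities, and the `ρ`-terms take the shape treated
    -- by `exists_coercive`.
    have hwd : w (k + 1) - w k = (γ⁻¹ • e - f) - (vbar (k + 1) - vbar k) := by
      rw [hwk, hwk, he, hf]
      module
    have hgd : g (k + 1) - g k = (τ⁻¹ • f - e) + (ibar (k + 1) - ibar k) := by
      rw [hgk, hgk, he, hf]
      module
    rw [hpe, hqf]
    rw [hwd] at hRk
    rw [hgd] at hGk
    have k1 := hco₁ (vbar (k + 1) - vbar k) (γ⁻¹ • e - f)
    have k2 := hco₂ (-(ibar (k + 1) - ibar k)) (τ⁻¹ • f - e)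
    rw [norm_neg, sub_neg_eq_add] at k2
    rw [inner_sub_right] at hRk
    rw [inner_add_right, real_inner_comm] at hGk
    have m1 := mul_le_mul_of_nonneg_right (min_le_left c₁ c₂)
      (sq_nonneg ‖vbar (k + 1) - vbar k‖)
    have m2 := mul_le_mul_of_nonneg_right (min_le_right c₁ c₂)
      (sq_nonneg ‖ibar (k + 1) - ibar k‖)
    have hcm := real_inner_comm (ibar (k + 1) - ibar k) (vbar (k + 1) - vbar k)
    have hcm' := real_inner_comm (τ⁻¹ • f - e) (vbar (k + 1) - vbar k)
    linarith
  have hgeo : ∀ k, precondSq γ⁻¹ τ⁻¹ (i (k + 1) - i k) (v (k + 1) - v k) ≤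
      precondSq γ⁻¹ τ⁻¹ (i 1 - i 0) (v 1 - v 0) * θ ^ k := fun k => by
    induction k with
    | zero => simp
    | succ k ih =>
      refine (hstep k).trans ((mul_le_mul_of_nonneg_left ih hθ).trans_eq ?_)
      ring
  have hcauchy : ∀ {x : ℕ → E} {c : ℝ}, 0 < c →
      (∀ k, c * ‖x (k + 1) - x k‖ ^ 2 ≤
        precondSq γ⁻¹ τ⁻¹ (i (k + 1) - i k) (v (k + 1) - v k)) → CauchySeq x := by
    intro x c hc hx
    refine cauchySeq_of_norm_sq_le_geometric
      (B := precondSq γ⁻¹ τ⁻¹ (i 1 - i 0) (v 1 - v 0) / c) hθ hθ1 fun k => ?_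
    rw [div_mul_eq_mul_div, le_div_iff₀ hc, mul_comm]
    exact (hx k).trans (hgeo k)
  have hci : CauchySeq i := hcauchy (c := γ⁻¹ - 1 / τ⁻¹)
    (sub_pos.2 (by rwa [div_lt_iff₀ hβ])) fun k => le_precondSq hβ _ _
  have hcv : CauchySeq v := hcauchy (c := τ⁻¹ - 1 / γ⁻¹)
    (sub_pos.2 (by rwa [div_lt_iff₀ hα, mul_comm])) fun k => by
      rw [precondSq_comm]
      exact le_precondSq hα _ _
  obtain ⟨iStar, hi⟩ := cauchySeq_tendsto_of_complete hci
  obtain ⟨vStar, hv⟩ := cauchySeq_tendsto_of_complete hcv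
  have hbar : ∀ {x xbar : ℕ → E} {l : E}, Tendsto x atTop (𝓝 l) →
      (∀ k, x (k + 1) = x k + lam • (xbar k - x k)) → Tendsto xbar atTop (𝓝 l) := by
    intro x xbar l hx hxbar
    have e : xbar = fun k => lam⁻¹ • (x (k + 1) - x k) + x k := by
      ext1 k
      rw [hxbar k, add_sub_cancel_left, inv_smul_smul₀ hlam.ne', sub_add_cancel]
    rw [e]
    simpa using ((((tendsto_add_atTop_iff_nat 1).2 hx).sub hx).const_smul lam⁻¹).add hx
  have hib := hbar hi hi'
  have hvb := hbar hv hv'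
  refine ⟨iStar, vStar, hRo _ _ ibar w hib ?_ hw, hGo _ _ vbar g hvb ?_ hg, hi, hv⟩
  · rw [funext hwk]
    simpa using ((((hi.sub hib).const_smul γ⁻¹).sub hv).sub_const s)
  · rw [funext hgk]
    have := (((hv.sub hvb).const_smul τ⁻¹).add (hib.const_smul (2 : ℝ))).sub hi
    simpa [two_smul] using this

end SetValuedMap

/-! ### Semimonotonicity of the transistor and the amplifier. -/

namespace Circuit

open SetValuedMap

lemma IsSemimonotone.prodMap {A B : SetValuedMap ℝ ℝ} {μ ρ : ℝ} (hA : A.IsSemimonotone μ ρ)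
    (hB : B.IsSemimonotone μ ρ) : (prodMap A B).IsSemimonotone μ ρ := by
  intro x y u w hu hw
  have h1 := hA _ _ _ _ hu.1 hw.1
  have h2 := hB _ _ _ _ hu.2 hw.2
  simp only [EuclideanSpace.norm_sq_eq, PiLp.inner_apply, Fin.sum_univ_two, PiLp.sub_apply]
  linarith

lemma OuterSemicontinuous.prodMap {A B : SetValuedMap ℝ ℝ} (hA : A.OuterSemicontinuous)
    (hB : B.OuterSemicontinuous) : (prodMap A B).OuterSemicontinuous := by
  intro x u xs us hx hu h
  have hc : ∀ (j : Fin 2), Continuous fun z : EuclideanSpace ℝ (Fin 2) => z j := fun j => by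
    fun_prop
  exact ⟨hA _ _ _ _ (((hc 0).tendsto x).comp hx) (((hc 0).tendsto u).comp hu) fun k => (h k).1,
    hB _ _ _ _ (((hc 1).tendsto x).comp hx) (((hc 1).tendsto u).comp hu) fun k => (h k).2⟩

/-- The mixing matrix is invertible, so the graph is a continuous preimage of the graph of `prodMap
TD TD`. -/
lemma leakyNPN_outerSemicontinuous {r αR αF : ℝ} {TD : SetValuedMap ℝ ℝ}
    (hα : αR * αF ≠ 1) (hTD : TD.OuterSemicontinuous) :
    (leakyNPN r αR αF TD).OuterSemicontinuous := by
  intro x y xs ys hx hy h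
  set M : Matrix (Fin 2) (Fin 2) ℝ := !![1, -αR; -αF, 1] with hM
  have hdet : IsUnit M.det := by
    rw [hM, Matrix.det_fin_two_of, isUnit_iff_ne_zero]
    intro h0
    exact hα (by linarith)
  have hinv : ∀ z, Matrix.toEuclideanLin M⁻¹ (Matrix.toEuclideanLin M z) = z := fun z => by
    rw [Matrix.toLpLin_apply, Matrix.toLpLin_apply, Matrix.mulVec_mulVec,
      Matrix.nonsing_inv_mul _ hdet, Matrix.one_mulVec]
  have hinv' : ∀ z, Matrix.toEuclideanLin M (Matrix.toEuclideanLin M⁻¹ z) = z := fun z => by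
    rw [Matrix.toLpLin_apply, Matrix.toLpLin_apply, Matrix.mulVec_mulVec,
      Matrix.mul_nonsing_inv _ hdet, Matrix.one_mulVec]
  have hmem : ∀ z t, t ∈ leakyNPN r αR αF TD z ↔
      Matrix.toEuclideanLin M⁻¹ (t - (1 / r) • z) ∈ prodMap TD TD z := by
    intro z t
    constructor
    · rintro ⟨_, ⟨u, hu, rfl⟩, _, rfl, rfl⟩
      simpa [← hM, hinv] using hu
    · intro hu
      exact ⟨_, ⟨_, hu, rfl⟩, _, rfl, by simp [← hM, hinv']⟩
  rw [hmem]
  refine OuterSemicontinuous.prodMap hTD hTD x _ xs _ hx ?_ fun k => (hmem _ _).1 (h k)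
  exact ((Matrix.toEuclideanLin M⁻¹).continuous_of_finiteDimensional.tendsto _).comp
    (hy.sub (hx.const_smul _))

/-- Replacing `α`, `β` by `1` only lowers both entries; their sum is then at least `v₁ + v₂`. -/
lemma half_sq_le_of_nonneg {α β u₁ u₂ v₁ v₂ : ℝ} (hα : α ∈ Set.Ico (0 : ℝ) 1)
    (hβ : β ∈ Set.Ico (0 : ℝ) 1) (h₁ : 0 ≤ u₁) (h₂ : 0 ≤ u₂) (k₁ : 0 ≤ v₁) (k₂ : 0 ≤ v₂) :
    v₁ ^ 2 + v₂ ^ 2 ≤ 2 * ((u₁ - α * u₂ + v₁) ^ 2 + (u₂ - β * u₁ + v₂) ^ 2) := by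
  have hx : v₁ + (u₁ - u₂) ≤ u₁ - α * u₂ + v₁ := by nlinarith [hα.2]
  have hz : v₂ + (u₂ - u₁) ≤ u₂ - β * u₁ + v₂ := by nlinarith [hβ.2]
  set x := u₁ - α * u₂ + v₁
  set z := u₂ - β * u₁ + v₂
  have hv : 0 ≤ v₁ * v₂ := mul_nonneg k₁ k₂
  have hxz : (v₁ + v₂) ^ 2 ≤ (x + z) ^ 2 := pow_le_pow_left₀ (by positivity) (by linarith) 2
  nlinarith [sq_nonneg (x - z)]

/-- Like signs reduce to the previous lemma; for opposite signs the mixing only enlarges each entry.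
-/
lemma half_sq_le {α β u₁ u₂ v₁ v₂ : ℝ} (hα : α ∈ Set.Ico (0 : ℝ) 1)
    (hβ : β ∈ Set.Ico (0 : ℝ) 1) (h₁ : 0 ≤ u₁ * v₁) (h₂ : 0 ≤ u₂ * v₂) :
    v₁ ^ 2 + v₂ ^ 2 ≤ 2 * ((u₁ - α * u₂ + v₁) ^ 2 + (u₂ - β * u₁ + v₂) ^ 2) := by
  have key : ∀ {u v : ℝ}, 0 ≤ u * v → (0 ≤ u ∧ 0 ≤ v) ∨ (u ≤ 0 ∧ v ≤ 0) := fun h =>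
    mul_nonneg_iff.1 h
  have opp : ∀ {x y : ℝ}, 0 ≤ y → y ≤ x → y ^ 2 ≤ x ^ 2 := fun h h' => pow_le_pow_left₀ h h' 2
  rcases key h₁ with ⟨a₁, b₁⟩ | ⟨a₁, b₁⟩ <;> rcases key h₂ with ⟨a₂, b₂⟩ | ⟨a₂, b₂⟩
  · exact half_sq_le_of_nonneg hα hβ a₁ a₂ b₁ b₂
  · have := mul_nonneg hα.1 (neg_nonneg.2 a₂)
    have := mul_nonneg hβ.1 a₁
    have p := opp b₁ (by linarith : v₁ ≤ u₁ - α * u₂ + v₁)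
    have q := opp (neg_nonneg.2 b₂) (by linarith : -v₂ ≤ -(u₂ - β * u₁ + v₂))
    nlinarith [sq_nonneg v₁, sq_nonneg v₂]
  · have := mul_nonneg hα.1 a₂
    have := mul_nonneg hβ.1 (neg_nonneg.2 a₁)
    have p := opp (neg_nonneg.2 b₁) (by linarith : -v₁ ≤ -(u₁ - α * u₂ + v₁))
    have q := opp b₂ (by linarith : v₂ ≤ u₂ - β * u₁ + v₂)
    nlinarith [sq_nonneg v₁, sq_nonneg v₂]
  · have := half_sq_le_of_nonneg hα hβ (neg_nonneg.2 a₁) (neg_nonneg.2 a₂) (neg_nonneg.2 b₁)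
      (neg_nonneg.2 b₂)
    nlinarith

/-- The leaky transistor is `((4s² + 4s - 1) / (8sr), -sr)`-semimonotone for every `s > 0`. -/
lemma leakyNPN_isSemimonotone {r αR αF s : ℝ} {TD : SetValuedMap ℝ ℝ} (hr : 0 < r) (hs : 0 < s)
    (hαR : αR ∈ Set.Ico (0 : ℝ) 1) (hαF : αF ∈ Set.Ico (0 : ℝ) 1) (hTD : TD.IsMonotone) :
    (leakyNPN r αR αF TD).IsSemimonotone ((4 * s ^ 2 + 4 * s - 1) / (8 * s * r)) (-(s * r)) := by
  rintro x y _ _ ⟨_, ⟨u, hu, rfl⟩, _, rfl, rfl⟩ ⟨_, ⟨w, hw, rfl⟩, _, rfl, rfl⟩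
  have h1 := hTD _ _ _ _ hu.1 hw.1
  have h2 := hTD _ _ _ _ hu.2 hw.2
  -- Completing the square in `sr‖y‖² + ⟨x, y⟩` shifts the leakage `1/r` by `1/(2sr)`; `t` is their
  -- sum.
  set t := (2 * s + 1) / (2 * s * r) with ht
  have ht0 : 0 < t := by positivity
  have hm := half_sq_le (u₁ := u 0 - w 0) (u₂ := u 1 - w 1) (v₁ := t * (x 0 - y 0))
    (v₂ := t * (x 1 - y 1)) hαR hαF
    (by
      change 0 ≤ (u 0 - w 0) * (x 0 - y 0) at h1
      linarith [mul_nonneg ht0.le h1])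
    (by
      change 0 ≤ (u 1 - w 1) * (x 1 - y 1) at h2
      linarith [mul_nonneg ht0.le h2])
  simp only [EuclideanSpace.norm_sq_eq, PiLp.inner_apply, Fin.sum_univ_two, PiLp.sub_apply,
    PiLp.add_apply, PiLp.smul_apply, Matrix.toLpLin_apply, Matrix.mulVec, dotProduct,
    Matrix.of_apply, Matrix.cons_val', Matrix.cons_val_zero, Matrix.cons_val_one,
    Real.norm_eq_abs, sq_abs, smul_eq_mul]
  have hsr : 0 < s * r := by positivity
  have := mul_le_mul_of_nonneg_left hm hsr.le
  rw [← sub_nonneg] at this ⊢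
  refine (div_nonneg this two_pos.le).trans_eq ?_
  simp only [inner, ht]
  simp
  field_simp
  ring

/-- The Chambolle--Pock iterates of the common-emitter amplifier converge to a solution whenever
the moduli of the loads compensate those of the transistor with some slack. -/
theorem commonEmitter_tendsto {αR αF r : ℝ} {TD RC RE : SetValuedMap ℝ ℝ}
    (hαR : αR ∈ Set.Ico (0 : ℝ) 1) (hαF : αF ∈ Set.Ico (0 : ℝ) 1)
    (hTD_mono : TD.IsMonotone) (hTD_osc : TD.OuterSemicontinuous) (hr : 0 < r)
    (hRC_osc : RC.OuterSemicontinuous) (hRE_osc : RE.OuterSemicontinuous)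
    {μ ρ a b s γ τ lam : ℝ} (hRC : RC.IsSemimonotone μ (-ρ)) (hRE : RE.IsSemimonotone μ (-ρ))
    (hρ : 0 ≤ ρ) (hs : 0 < s) (ha : ρ < a) (hb : s * r < b)
    (hav : ρ ^ 2 < (a - ρ) * ((4 * s ^ 2 + 4 * s - 1) / (8 * s * r) - ρ))
    (hbi : (s * r) ^ 2 < (b - s * r) * (μ - s * r))
    (hγ : 0 < γ) (hτ : 0 < τ) (hγτ : γ * τ < 1)
    (hlam : 0 < lam) (hlam' : lam < 2 * (1 - (a / γ + b / τ)))
    {s_v : EuclideanSpace ℝ (Fin 2)} {i v : ℕ → EuclideanSpace ℝ (Fin 2)}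
    (hCP : IsChambollePock (prodMap RC RE) (leakyNPN r αR αF TD)
      (1 : Matrix (Fin 2) (Fin 2) ℝ) s_v 0 γ τ lam i v) :
    ∃ iStar vStar : EuclideanSpace ℝ (Fin 2),
      IsSolution (prodMap RC RE) (leakyNPN r αR αF TD) (1 : Matrix (Fin 2) (Fin 2) ℝ)
        s_v 0 iStar vStar ∧
      Tendsto i atTop (𝓝 iStar) ∧ Tendsto v atTop (𝓝 vStar) := by
  have hone : ∀ z : EuclideanSpace ℝ (Fin 2),
      Matrix.toEuclideanLin (1 : Matrix (Fin 2) (Fin 2) ℝ) z = z := fun z => by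
    simp
  obtain ⟨ibar, vbar, h⟩ := hCP
  simp only [Matrix.transpose_one, hone] at h
  have hw : ∀ k, ∃ w ∈ prodMap RC RE (ibar k), ibar k + γ • (w + s_v) = i k - γ • v k := by
    intro k
    obtain ⟨_, rfl, _, ⟨_, ⟨w, hw, _, rfl, rfl⟩, rfl⟩, e⟩ := (h k).1
    exact ⟨w, hw, e⟩
  have hg : ∀ k, ∃ g ∈ leakyNPN r αR αF TD (vbar k),
      vbar k + τ • g = v k + τ • ((2 : ℝ) • ibar k - i k) := by
    intro k
    obtain ⟨_, rfl, _, ⟨_, ⟨g, hg, _, rfl, rfl⟩, rfl⟩, e⟩ := (h k).2.1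
    exact ⟨g, hg, by simpa using e⟩
  choose w hw hwe using hw
  choose g hg hge using hg
  have hα : αR * αF ≠ 1 := (mul_lt_one_of_nonneg_of_lt_one_left hαR.1 hαR.2 hαF.2.le).ne
  obtain ⟨iStar, vStar, hi, hv, hti, htv⟩ := chambollePock_tendsto
    (OuterSemicontinuous.prodMap hRC_osc hRE_osc) (leakyNPN_outerSemicontinuous hα hTD_osc)
    (IsSemimonotone.prodMap hRC hRE) (leakyNPN_isSemimonotone hr hs hαR hαF hTD_mono)
    hρ (by positivity) ha hb hav hbi hγ hτ hγτ hlam hlam' s_v hw hg hwe hge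
    (fun k => (h k).2.2.1) fun k => (h k).2.2.2
  refine ⟨iStar, vStar, ⟨?_, ?_⟩, hti, htv⟩
  · rw [Matrix.transpose_one, hone]
    exact ⟨_, ⟨_, hi, _, rfl, rfl⟩, _, rfl, by dsimp only; abel⟩
  · rw [hone]
    exact ⟨_, ⟨_, hv, _, rfl, rfl⟩, _, rfl, by simp⟩

end Circuit

/-! ### The two stepsize regimes. -/

lemma SetValuedMap.IsSigmaMonotone.isSemimonotone {E : Type*} [NormedAddCommGroup E]
    [InnerProductSpace ℝ E] {A : SetValuedMap E E} {σ : ℝ} (h : A.IsSigmaMonotone σ) :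
    A.IsSemimonotone σ (-0) := by
  intro x y u w hu hw
  simpa using h x y u w hu hw

theorem proposition8
    (αR αF r vin vplus : ℝ) (TD RC RE : SetValuedMap ℝ ℝ)
    (hαR : αR ∈ Set.Ico (0 : ℝ) 1) (hαF : αF ∈ Set.Ico (0 : ℝ) 1)
    (hTD_mono : TD.IsMonotone) (hTD_osc : TD.OuterSemicontinuous)
    (hr : 0 < r) (hvplus : 0 < vplus)
    (hRC_osc : RC.OuterSemicontinuous) (hRE_osc : RE.OuterSemicontinuous)
    (γ τ lam : ℝ)
    (hcase :
      (∃ σ τ₀ : ℝ,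
        r * (Real.sqrt 2 - 1) / 2 < σ ∧
        RC.IsSigmaMonotone σ ∧ RE.IsSigmaMonotone σ ∧
        τ₀ = -(σ * r * (1 - Real.sqrt 2) / (r * (1 - Real.sqrt 2) + 2 * σ)) ∧
        τ ∈ Set.Ioi τ₀ ∧
        γ ∈ Set.Ioo 0 (1 / τ) ∧
        lam ∈ Set.Ioo 0 (2 * (1 - τ₀ / τ))) ∨
      (∃ γ₀ γ₁ : ℝ,
        RC.IsSemimonotone (9 / 8 * r) (-(1 / (8 * r))) ∧
        RE.IsSemimonotone (9 / 8 * r) (-(1 / (8 * r))) ∧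
        γ₀ = (5 - Real.sqrt 10) / (9 * r) ∧
        γ₁ = (5 + Real.sqrt 10) / (9 * r) ∧
        γ ∈ Set.Ioo γ₀ γ₁ ∧
        τ ∈ Set.Ioo (1 / γ₁) (1 / γ) ∧
        lam ∈ Set.Ioo 0 (2 * (1 - 1 / (6 * r * γ) - 9 / (10 * τ) * r))))
    (i v : ℕ → EuclideanSpace ℝ (Fin 2))
    (hCP : Circuit.IsChambollePock
      (Circuit.prodMap RC RE) (Circuit.leakyNPN r αR αF TD) (1 : Matrix (Fin 2) (Fin 2) ℝ)
      !₂[vplus - vin, -vin] 0 γ τ lam i v) :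
    ∃ iStar vStar : EuclideanSpace ℝ (Fin 2),
      Circuit.IsSolution
        (Circuit.prodMap RC RE) (Circuit.leakyNPN r αR αF TD) (1 : Matrix (Fin 2) (Fin 2) ℝ)
        !₂[vplus - vin, -vin] 0 iStar vStar ∧
      Filter.Tendsto i Filter.atTop (nhds iStar) ∧
      Filter.Tendsto v Filter.atTop (nhds vStar) := by
  obtain ⟨σ, τ₀, hσ, hRC, hRE, hτ₀, hτ, hγ, hlam⟩ | ⟨γ₀, γ₁, hRC, hRE, hγ₀, hγ₁, hγ, hτ, hlam⟩ := hcase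
  · have hsq : Real.sqrt 2 ^ 2 = 2 := Real.sq_sqrt (by norm_num)
    have hsq1 : 1 < Real.sqrt 2 := by
      rw [Real.lt_sqrt (by norm_num)]
      norm_num
    -- The positive root of `4s² + 4s - 1`, where the transistor modulus vanishes. There the infimum
    -- of admissible `b` is `τ₀`; `s` is taken slightly larger to make the modulus positive, after
    -- which any `a > 0` works.
    set s₀ := (Real.sqrt 2 - 1) / 2 with hs₀
    have hs₀pos : 0 < s₀ := by linarith
    have hσs : 0 < σ - s₀ * r := by rw [hs₀]; linarith
    have hs₀r : 0 < s₀ * r := mul_pos hs₀pos hr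
    have hτ₀eq : τ₀ * (σ - s₀ * r) = σ * (s₀ * r) := by
      have hd : r * (1 - Real.sqrt 2) + 2 * σ = 2 * (σ - s₀ * r) := by rw [hs₀]; ring
      have hn : 1 - Real.sqrt 2 = -(2 * s₀) := by rw [hs₀]; ring
      rw [hτ₀, hd, hn]
      have hσs' := hσs.ne'
      clear_value s₀
      generalize σ - s₀ * r = d at *
      field_simp
    have hτ₀pos : 0 < τ₀ := by
      by_contra! hneg
      nlinarith [mul_pos (by linarith : 0 < σ) hs₀r]
    have hτpos : 0 < τ := hτ₀pos.trans hτ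
    obtain ⟨b, hb₀, hb₁⟩ : ∃ b, τ₀ < b ∧ b < τ * (1 - lam / 2) := exists_between <| by
      have h1 : τ₀ / τ < 1 - lam / 2 := by linarith [hlam.2]
      rwa [div_lt_iff₀ hτpos, mul_comm] at h1
    have hf0 : 0 < (b - s₀ * r) * (σ - s₀ * r) - (s₀ * r) ^ 2 := by
      nlinarith [mul_lt_mul_of_pos_right hb₀ hσs]
    have hev : ∀ᶠ s in 𝓝[>] s₀, 0 < (b - s * r) * (σ - s * r) - (s * r) ^ 2 ∧
        0 < σ - s * r ∧ s₀ < s := by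
      have c₁ : Continuous fun s : ℝ => (b - s * r) * (σ - s * r) - (s * r) ^ 2 := by fun_prop
      have c₂ : Continuous fun s : ℝ => σ - s * r := by fun_prop
      exact (((c₁.tendsto s₀).eventually_const_lt hf0).filter_mono nhdsWithin_le_nhds).and
        ((((c₂.tendsto s₀).eventually_const_lt hσs).filter_mono nhdsWithin_le_nhds).and
          self_mem_nhdsWithin)
    obtain ⟨s, hs, hs', hss⟩ := hev.exists
    have hspos : 0 < s := hs₀pos.trans hss
    have hb : s * r < b := by
      by_contra! hneg
      nlinarith [sq_nonneg (s * r)]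
    have hD : 0 < 1 - lam / 2 - b / τ := by
      rw [sub_pos, div_lt_iff₀ hτpos]
      linarith
    have hm : 0 < 4 * s ^ 2 + 4 * s - 1 := by nlinarith
    have ha : 0 < γ * ((1 - lam / 2 - b / τ) / 2) := mul_pos hγ.1 (by linarith)
    refine Circuit.commonEmitter_tendsto hαR hαF hTD_mono hTD_osc hr hRC_osc hRE_osc
      hRC.isSemimonotone hRE.isSemimonotone le_rfl hspos ha hb ?_ (by linarith) hγ.1 hτpos
      ((lt_div_iff₀ hτpos).1 hγ.2) hlam.1 ?_ hCP
    · rw [sub_zero, sub_zero, zero_pow two_ne_zero]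
      exact mul_pos ha (by positivity)
    · rw [mul_div_cancel_left₀ _ hγ.1.ne']
      linarith
  · have hsq5 : Real.sqrt 10 < 5 := by
      rw [Real.sqrt_lt' (by norm_num)]
      norm_num
    have hγpos : 0 < γ := hγ.1.trans' (hγ₀ ▸ div_pos (by linarith) (by positivity))
    have hτpos : 0 < τ := hτ.1.trans' (by rw [hγ₁]; positivity)
    set D := 1 - 1 / (6 * r * γ) - 9 / (10 * τ) * r - lam / 2 with hD
    have hDpos : 0 < D := by linarith [hlam.2]
    -- At `s = 1/2` the transistor moduli are `1/(2r)` and `-r/2`. The thresholds `ρ + ρ²/(μ - ρ)`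
    -- for `a` and `b` are then `1/(6r)` and `9r/10`; the slack `D` pays for strictness in both.
    refine Circuit.commonEmitter_tendsto (s := 1 / 2) (a := 1 / (6 * r) + γ * (D / 4))
      (b := 9 / 10 * r + τ * (D / 4)) hαR hαF hTD_mono hTD_osc hr hRC_osc hRE_osc
      hRC hRE (by positivity) (by norm_num) ?_ ?_ ?_ ?_ hγpos hτpos
      (by rw [mul_comm]; exact (lt_div_iff₀ hγpos).1 hτ.2) hlam.1 ?_ hCP
    · have h1 : 1 / (6 * r) - 1 / (8 * r) = 1 / (24 * r) := by field_simp; norm_num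
      have : 0 < 1 / (24 * r) := by positivity
      have := mul_pos hγpos (by linarith : 0 < D / 4)
      linarith
    · have := mul_pos hτpos (by linarith : 0 < D / 4)
      linarith
    · have h1 : (1 / (6 * r) + γ * (D / 4) - 1 / (8 * r)) *
          ((4 * (1 / 2) ^ 2 + 4 * (1 / 2) - 1) / (8 * (1 / 2) * r) - 1 / (8 * r)) =
          (1 / (8 * r)) ^ 2 + γ * (D / 4) * (3 / (8 * r)) := by
        field_simp
        ring
      rw [h1]
      have : 0 < γ * (D / 4) * (3 / (8 * r)) := by positivity
      linarith
    · have : 0 < τ * D * r := by positivity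
      nlinarith
    · have h1 : (1 / (6 * r) + γ * (D / 4)) / γ + (9 / 10 * r + τ * (D / 4)) / τ =
          1 / (6 * r * γ) + 9 / (10 * τ) * r + D / 2 := by
        field_simp
        ring
      rw [h1]
      linarith
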